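/- Let $\mu$ be a finite (positive) Borel measure on $\mathbb{C}$ whose support is compact and infinite. Let $\Phi_n$ be the monic orthogonal polynomial of degree $n$ obtained from $1,z,z^2,\dots$ by Gram–Schmidt orthogonalization in $L^2(\mu)$, and let $\varphi_n=\kappa_n\Phi_n$, $\kappa_n=\|\Phi_n\|_{L^2(\mu)}^{-1}>0$, be the corresponding orthonormal polynomial. For $n\ge 1$ let $$\nu_n=\frac1n\sum_{k=1}^n\delta_{z_k},$$ where $z_1,\dots,z_n$ are the zeros of $\varphi_n$, each listed according to its multiplicity. Suppose that there are a real number $R>0$ and a function $f$ analytic in $\{z: R<|z|\le\infty\}$ such that $$\lim_{n\to\infty}\frac{\Phi_n(z)}{\Phi_{n+1}(z)}=f(z)\qquad\text{for every } z \text{ with } R<|z|\le\infty$$ (at $z=\infty$ the quotient takes its value as a rational function on the Riemann sphere). Then for every integer $j\ge 0$ both limits $$\lim_{n\to\infty}\int z^j\,d\nu_n(z)\qquad\text{and}\qquad\lim_{n\to\infty}\int z^j\,|\varphi_n(z)|^2\,d\mu(z)$$ exist, and they are equal. -/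

import Mathlib

open MeasureTheory Filter Topology Polynomial
open scoped ENNReal ComplexConjugate

noncomputable section

namespace OrthoPoly

/-- The `L²(μ)` inner product `∫ conj p · q dμ` of two polynomials, conjugate-linear in the
first argument. -/
def polyInner (μ : Measure ℂ) (p q : ℂ[X]) : ℂ :=
  ∫ z, conj (p.eval z) * q.eval z ∂μ

/-- The monic orthogonal polynomials `Φ_n` of `μ`: Gram-Schmidt orthogonalization, in `L²(μ)`,
of the sequence `1, z, z², …` (without normalization, so that `Φ_n` is monic of degree `n`). -/
def monicPoly (μ : Measure ℂ) (n : ℕ) : ℂ[X] :=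
  X ^ n - ∑ k : Fin n,
    C (polyInner μ (monicPoly μ k) (X ^ n) / polyInner μ (monicPoly μ k) (monicPoly μ k)) *
      monicPoly μ k
termination_by n
decreasing_by all_goals exact k.2

/-- The leading coefficient `κ_n = 1 / ‖Φ_n‖_{L²(μ)} > 0` of the orthonormal polynomial. -/
def leadCoeff (μ : Measure ℂ) (n : ℕ) : ℝ :=
  (√(∫ z, ‖(monicPoly μ n).eval z‖ ^ 2 ∂μ))⁻¹

/-- The orthonormal polynomials `φ_n = κ_n Φ_n` of `μ`. -/
def orthonormalPoly (μ : Measure ℂ) (n : ℕ) : ℂ[X] :=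
  C (leadCoeff μ n : ℂ) * monicPoly μ n

/-- The normalized zero-counting measure `ν_n = (1/n) ∑ δ_{z_j}`, the sum being over the zeros
of `φ_n`, each repeated according to its multiplicity. -/
def zeroCounting (μ : Measure ℂ) (n : ℕ) : Measure ℂ :=
  (n : ℝ≥0∞)⁻¹ • ((orthonormalPoly μ n).roots.map fun z => Measure.dirac z).sum

/-- The set `{z : R < |z| ≤ ∞}` in the Riemann sphere. -/
def exterior (R : ℝ) : Set (OnePoint ℂ) :=
  insert OnePoint.infty ((fun z : ℂ => (z : OnePoint ℂ)) '' {z : ℂ | R < ‖z‖})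

/-- The coordinate `w ↦ 1/w` of the Riemann sphere centred at `∞`. -/
def chartAtInfty (w : ℂ) : OnePoint ℂ :=
  if w = 0 then OnePoint.infty else ((w⁻¹ : ℂ) : OnePoint ℂ)

/-- `f` is analytic in `{z : R < |z| ≤ ∞}`: it is analytic at each finite point, and
`w ↦ f (1/w)` is analytic at `w = 0`. -/
structure AnalyticOnExterior (f : OnePoint ℂ → ℂ) (R : ℝ) : Prop where
  finite : AnalyticOnNhd ℂ (fun z : ℂ => f (z : OnePoint ℂ)) {z : ℂ | R < ‖z‖}
  infty : AnalyticAt ℂ (fun w : ℂ => f (chartAtInfty w)) 0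

/-- The value of the rational function `p / q` at a point of the Riemann sphere; at `∞` it is
the limit of `p z / q z` as `|z| → ∞`. -/
def ratioAt (p q : ℂ[X]) : OnePoint ℂ → ℂ
  | OnePoint.infty => limUnder (cocompact ℂ) fun z => p.eval z / q.eval z
  | OnePoint.some z => p.eval z / q.eval z

end OrthoPoly

end

/-!
In the basis of the `Φ_n`, multiplication by `z` is a Hessenberg matrix `T`. Its `n × n` corner
`T_n` has characteristic polynomial `Φ_n`, so `∫ z ^ j dν_n = tr (T_n ^ j) / n`, whereas
`∫ z ^ j |φ_n| ^ 2 dμ` is the diagonal entry `(T ^ j)_{n,n}`. Only the last `j` diagonal entries of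
`T_n ^ j` differ from those of `T ^ j`, and all of them are bounded, so by Cesàro both limits exist
and agree as soon as `(T ^ j)_{n,n}` converges, hence as soon as `T` converges along its diagonals.
The recurrence `z Φ_n = Φ_{n+1} + ∑_{m ≤ n} T_{m,n} Φ_m` recovers the diagonals of `T` one after
another from the ratios `Φ_n(z) / Φ_{n+1}(z)` by letting `z → ∞`, uniformly in `n`.
-/

theorem cauchySeq_of_tendstoUniformly {ι α : Type*} [PseudoMetricSpace α] {l : Filter ι}
    {F : ι → ℕ → α} {t : ℕ → α} (hF : TendstoUniformly F t l)
    (hcauchy : ∃ᶠ i in l, CauchySeq (F i)) : CauchySeq t := by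
  refine Metric.cauchySeq_iff'.2 fun ε hε => ?_
  obtain ⟨i, hi, hclose⟩ :=
    (hcauchy.and_eventually (Metric.tendstoUniformly_iff.1 hF (ε / 3) (by positivity))).exists
  obtain ⟨N, hN⟩ := Metric.cauchySeq_iff'.1 hi (ε / 3) (by positivity)
  refine ⟨N, fun n hn => ?_⟩
  calc dist (t n) (t N)
      ≤ dist (t n) (F i n) + dist (F i n) (F i N) + dist (F i N) (t N) := dist_triangle4 _ _ _ _
    _ < ε / 3 + ε / 3 + ε / 3 := by
        gcongr
        · exact hclose n
        · exact hN n hn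
        · exact dist_comm (t N) _ ▸ hclose N
    _ = ε := by ring

theorem norm_sum_fin_le_of_eq_zero {E : Type*} [SeminormedAddCommGroup E] {n j : ℕ} {D : ℝ}
    (hD : 0 ≤ D) {e : Fin n → E} (hzero : ∀ k : Fin n, k + j < n → e k = 0)
    (hbound : ∀ k, ‖e k‖ ≤ D) : ‖∑ k, e k‖ ≤ j * D := by
  set s : Finset (Fin n) := {k | n ≤ k + j}
  have hcard : s.card ≤ j := by
    calc s.card = (s.map Fin.valEmbedding).card := (Finset.card_map _).symm
      _ ≤ (Finset.Ico (n - j) n).card := Finset.card_le_card fun k hk => by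
          obtain ⟨i, hi, rfl⟩ := Finset.mem_map.1 hk
          exact Finset.mem_Ico.2
            ⟨Nat.sub_le_iff_le_add.2 ((Finset.mem_filter_univ i).1 hi), i.2⟩
      _ ≤ j := by rw [Nat.card_Ico]; lia
  have hsum : ∑ k, e k = ∑ k ∈ s, e k :=
    (Finset.sum_subset (Finset.subset_univ s) fun k _ hk => hzero k (by
      simpa only [s, Finset.mem_filter_univ, not_le] using hk)).symm
  calc ‖∑ k, e k‖ = ‖∑ k ∈ s, e k‖ := by rw [hsum]
    _ ≤ ∑ _k ∈ s, D := norm_sum_le_of_le s fun k _ => hbound k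
    _ = s.card * D := by rw [Finset.sum_const, nsmul_eq_mul]
    _ ≤ j * D := by gcongr

/-! ### Powers of a matrix -/

section Matrix

variable {n K : Type*} [Fintype n] [DecidableEq n]

theorem det_aeval_eq_prod_roots_charpoly [Field K] [IsAlgClosed K] (A : Matrix n n K) (p : K[X]) :
    (aeval A p).det = (A.charpoly.roots.map p.eval).prod := by
  have hsplit : A.charpoly.Splits := IsAlgClosed.splits _
  have hcard : A.charpoly.roots.card = Fintype.card n := by
    rw [← hsplit.natDegree_eq_card_roots, A.charpoly_natDegree_eq_dim]
  have hconst (c : K) : (aeval A (C c)).det = (A.charpoly.roots.map (C c).eval).prod := by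
    simp [Matrix.algebraMap_eq_diagonal, hcard]
  have hlinear (a : K) :
      (aeval A (X - C a)).det = (A.charpoly.roots.map (X - C a).eval).prod := by
    calc (aeval A (X - C a)).det = (-(Matrix.scalar n a - A)).det := by
          congr 1
          simp [Matrix.algebraMap_eq_diagonal, Pi.algebraMap_def]
      _ = (-1) ^ Fintype.card n * (A.charpoly.roots.map (a - ·)).prod := by
          rw [Matrix.det_neg, ← Matrix.eval_charpoly,
            hsplit.eval_eq_prod_roots_of_monic A.charpoly_monic]
      _ = _ := by
          rw [← hcard, ← Multiset.card_map (a - ·), ← Multiset.prod_map_neg, Multiset.map_map]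
          simp
  rw [(IsAlgClosed.splits p).eq_prod_roots]
  induction p.roots using Multiset.induction_on with
  | empty => simpa using hconst p.leadingCoeff
  | cons a s ih =>
    rw [Multiset.map_cons, Multiset.prod_cons, mul_left_comm, map_mul, Matrix.det_mul, ih, hlinear,
      ← Multiset.prod_map_mul]
    simp only [eval_mul]

theorem roots_charpoly_aeval [Field K] [IsAlgClosed K] (A : Matrix n n K) (p : K[X]) :
    (aeval A p).charpoly.roots = A.charpoly.roots.map p.eval := by
  suffices (aeval A p).charpoly = ((A.charpoly.roots.map p.eval).map fun a => X - C a).prod by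
    rw [this, roots_multiset_prod_X_sub_C]
  refine Polynomial.funext fun t => ?_
  have hshift : Matrix.scalar n t - aeval A p = aeval A (C t - p) := by
    simp [Matrix.algebraMap_eq_diagonal, Pi.algebraMap_def]
  rw [Matrix.eval_charpoly, hshift, det_aeval_eq_prod_roots_charpoly, eval_multiset_prod]
  simp [Multiset.map_map]

theorem trace_pow_eq_sum_roots_charpoly [Field K] [IsAlgClosed K] (A : Matrix n n K) (j : ℕ) :
    (A ^ j).trace = (A.charpoly.roots.map (· ^ j)).sum := by
  have h := roots_charpoly_aeval A (X ^ j)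
  rw [map_pow, aeval_X] at h
  rw [Matrix.trace_eq_sum_roots_charpoly, h]
  simp only [eval_pow, eval_X]

theorem norm_pow_apply_self_le_of_sum_mul_norm_le [NormedRing K] [NormOneClass K] {A : Matrix n n K}
    {w : n → ℝ} (hw : ∀ k, 0 < w k) {c : ℝ} (hA : ∀ l, ∑ k, w k * ‖A k l‖ ≤ c * w l)
    (j : ℕ) (l : n) : ‖(A ^ j) l l‖ ≤ c ^ j := by
  have hc : 0 ≤ c := nonneg_of_mul_nonneg_left
    ((Finset.sum_nonneg fun k _ => mul_nonneg (hw k).le (norm_nonneg _)).trans (hA l)) (hw l)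
  have hsum : ∀ l, ∑ k, w k * ‖(A ^ j) k l‖ ≤ c ^ j * w l := by
    induction j with
    | zero =>
      intro l
      rw [Finset.sum_eq_single l (fun k _ hk => by simp [Matrix.one_apply_ne hk]) (by simp)]
      simp
    | succ j ih =>
      intro l
      calc ∑ k, w k * ‖(A ^ (j + 1)) k l‖
          ≤ ∑ k, w k * ∑ m, ‖(A ^ j) k m‖ * ‖A m l‖ := by
            gcongr with k
            · exact (hw k).le
            · rw [pow_succ, Matrix.mul_apply]
              exact norm_sum_le_of_le _ fun m _ => norm_mul_le _ _
        _ = ∑ m, (∑ k, w k * ‖(A ^ j) k m‖) * ‖A m l‖ := by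
            simp only [Finset.mul_sum, Finset.sum_mul, mul_assoc]
            exact Finset.sum_comm
        _ ≤ ∑ m, c ^ j * w m * ‖A m l‖ := by
            gcongr with m
            exact ih m
        _ = c ^ j * ∑ m, w m * ‖A m l‖ := by simp only [mul_assoc, Finset.mul_sum]
        _ ≤ c ^ j * (c * w l) := by gcongr; exact hA l
        _ = c ^ (j + 1) * w l := by ring
  refine le_of_mul_le_mul_left ?_ (hw l)
  calc w l * ‖(A ^ j) l l‖ ≤ ∑ k, w k * ‖(A ^ j) k l‖ :=
        Finset.single_le_sum (f := fun k => w k * ‖(A ^ j) k l‖)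
          (fun k _ => mul_nonneg (hw k).le (norm_nonneg _)) (Finset.mem_univ l)
    _ ≤ w l * c ^ j := (hsum l).trans_eq (mul_comm _ _)

end Matrix

theorem memLp_of_isCompact_support {X E : Type*} [TopologicalSpace X] [MeasurableSpace X]
    [OpensMeasurableSpace X] [HereditarilyLindelofSpace X] [NormedAddCommGroup E]
    [SecondCountableTopologyEither X E] {μ : Measure X} [IsFiniteMeasure μ]
    (hc : IsCompact μ.support) {f : X → E} (hf : Continuous f) (p : ℝ≥0∞) : MemLp f p μ := by
  obtain ⟨C, hC⟩ := hc.exists_bound_of_continuousOn hf.continuousOn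
  refine MemLp.of_bound hf.aestronglyMeasurable C ?_
  filter_upwards [Measure.support_mem_ae] with x hx using hC x hx

theorem integrable_multiset_sum_dirac {X E : Type*} [MeasurableSpace X] [MeasurableSingletonClass X]
    [NormedAddCommGroup E] (f : X → E) (s : Multiset X) :
    Integrable f (s.map Measure.dirac).sum := by
  induction s using Multiset.induction_on with
  | empty => simp
  | cons a s ih =>
    rw [Multiset.map_cons, Multiset.sum_cons]
    exact (integrable_dirac enorm_lt_top).add_measure ih

theorem integral_multiset_sum_dirac {X E : Type*} [MeasurableSpace X] [MeasurableSingletonClass X]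
    [NormedAddCommGroup E] [NormedSpace ℝ E] [CompleteSpace E] (f : X → E) (s : Multiset X) :
    ∫ x, f x ∂(s.map Measure.dirac).sum = (s.map f).sum := by
  induction s using Multiset.induction_on with
  | empty => simp
  | cons a s ih =>
    rw [Multiset.map_cons, Multiset.sum_cons, Multiset.map_cons, Multiset.sum_cons,
      integral_add_measure (integrable_dirac enorm_lt_top) (integrable_multiset_sum_dirac f s),
      integral_dirac, ih]

/-! ### Multiplication by `X` in a basis of monic polynomials -/

namespace OrthoPoly

/-- A sequence of monic polynomials `P 0, P 1, …` with `P n` of degree `n`. -/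
structure MonicSequence (R : Type*) [Semiring R] extends Polynomial.Sequence R where
  monic' : ∀ n, (elems' n).Monic

namespace MonicSequence

section Algebra

variable {R : Type*} [CommRing R]

instance : CoeFun (MonicSequence R) fun _ => ℕ → R[X] := ⟨fun P => P.toSequence⟩

theorem monic (P : MonicSequence R) (n : ℕ) : (P n).Monic := P.monic' n

variable (P : MonicSequence R)

theorem zero_eq_one : P 0 = 1 :=
  (P.monic 0).natDegree_eq_zero.1 (P.toSequence.natDegree_eq 0)

theorem isUnit_leadingCoeff (n : ℕ) : IsUnit (P n).leadingCoeff := by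
  rw [(P.monic n).leadingCoeff]
  exact isUnit_one

variable [IsDomain R]

/-- The polynomials `P n` as a basis of `R[X]`. -/
noncomputable def basis : Module.Basis ℕ R R[X] := P.toSequence.basis P.isUnit_leadingCoeff

theorem basis_apply (n : ℕ) : P.basis n = P n := P.toSequence.basis_eq_self _ n

theorem repr_apply_self (k l : ℕ) : P.basis.repr (P l) k = if l = k then 1 else 0 := by
  rw [← basis_apply, Module.Basis.repr_self_apply]

theorem support_repr_subset {p : R[X]} {n : ℕ} (hp : p.degree < n) :
    (P.basis.repr p).support ⊆ Finset.range n := by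
  have hmem : p ∈ Submodule.span R (P.basis '' Set.Iio n) := by
    rw [funext P.basis_apply, P.toSequence.span_degreeLT fun i _ => P.isUnit_leadingCoeff i]
    exact mem_degreeLT.2 hp
  simpa [← Finset.coe_subset] using P.basis.mem_span_image.1 hmem

theorem repr_eq_zero_of_degree_lt {p : R[X]} {k : ℕ} (hp : p.degree < k) :
    P.basis.repr p k = 0 :=
  Finsupp.notMem_support_iff.1 fun hk =>
    Finset.notMem_range_self (P.support_repr_subset hp hk)

theorem sum_repr_smul {p : R[X]} {n : ℕ} (hp : p.degree < n) :
    ∑ k ∈ Finset.range n, P.basis.repr p k • P k = p := by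
  conv_rhs => rw [← P.basis.linearCombination_repr p, Finsupp.linearCombination_apply,
    Finsupp.sum_of_support_subset _ (P.support_repr_subset hp) _ (by simp)]
  simp only [basis_apply]

/-- The `(k, l)` entry of the matrix of multiplication by `X ^ j` in the basis `P`. -/
noncomputable def mulXPow (j k l : ℕ) : R := P.basis.repr (X ^ j * P l) k

/-- The `(k, l)` entry of the (Hessenberg) matrix of multiplication by `X` in the basis `P`. -/
noncomputable def mulX (k l : ℕ) : R := P.mulXPow 1 k l

theorem mulXPow_zero (k l : ℕ) : P.mulXPow 0 k l = if l = k then 1 else 0 := by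
  rw [mulXPow, pow_zero, one_mul, repr_apply_self]

theorem mulXPow_eq_zero {j k l : ℕ} (h : l + j < k) : P.mulXPow j k l = 0 := by
  refine P.repr_eq_zero_of_degree_lt ?_
  rw [degree_mul, degree_X_pow, Sequence.degree_eq]
  exact_mod_cast (add_comm j l).trans_lt h

theorem mulX_eq_zero {k l : ℕ} (h : l + 1 < k) : P.mulX k l = 0 := P.mulXPow_eq_zero h

theorem mulX_succ_self (l : ℕ) : P.mulX (l + 1) l = 1 := by
  have hX : (X * P l).degree = ((l + 1 : ℕ) : WithBot ℕ) := by
    rw [degree_mul, degree_X, Sequence.degree_eq, Nat.cast_add, Nat.cast_one, add_comm]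
  have hlt : (X * P l - P (l + 1)).degree < ((l + 1 : ℕ) : WithBot ℕ) := by
    rw [← hX]
    refine degree_sub_lt_left (by rw [hX, Sequence.degree_eq]) (monic_X.mul (P.monic l)).ne_zero ?_
    rw [(monic_X.mul (P.monic l)).leadingCoeff, (P.monic (l + 1)).leadingCoeff]
  have hzero := P.repr_eq_zero_of_degree_lt hlt
  rw [map_sub, Finsupp.sub_apply, repr_apply_self, if_pos rfl, sub_eq_zero] at hzero
  rw [mulX, mulXPow, pow_one, hzero]

theorem X_mul_eq_sum {l n : ℕ} (h : l + 1 < n) :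
    X * P l = ∑ k ∈ Finset.range n, P.mulX k l • P k := by
  have hdeg : (X * P l).degree < (n : WithBot ℕ) := by
    rw [degree_mul, degree_X, Sequence.degree_eq]
    exact_mod_cast (add_comm 1 l).trans_lt h
  simpa only [mulX, mulXPow, pow_one] using (P.sum_repr_smul hdeg).symm

theorem mulXPow_succ {l n : ℕ} (h : l + 1 < n) (j k : ℕ) :
    P.mulXPow (j + 1) k l = ∑ m ∈ Finset.range n, P.mulXPow j k m * P.mulX m l := by
  rw [mulXPow, pow_succ, mul_assoc, P.X_mul_eq_sum h, Finset.mul_sum, map_sum,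
    Finsupp.finsetSum_apply]
  refine Finset.sum_congr rfl fun m _ => ?_
  rw [mul_smul_comm, map_smul, Finsupp.smul_apply, smul_eq_mul, mul_comm, mulXPow]

/-- The upper left `n × n` corner of the matrix of multiplication by `X` in the basis `P`. -/
noncomputable def truncation (n : ℕ) : Matrix (Fin n) (Fin n) R :=
  Matrix.of fun k l => P.mulX k l

theorem truncation_pow_apply {n : ℕ} (j : ℕ) (k l : Fin n) (h : l + j < n) :
    (P.truncation n ^ j) k l = P.mulXPow j k l := by
  induction j generalizing l with
  | zero => simp [mulXPow_zero, Matrix.one_apply, Fin.ext_iff, eq_comm]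
  | succ j ih =>
    rw [pow_succ, Matrix.mul_apply, P.mulXPow_succ (by lia : (l : ℕ) + 1 < n), Finset.sum_range]
    refine Finset.sum_congr rfl fun m _ => ?_
    rcases le_or_gt (m : ℕ) (l + 1) with hm | hm
    · rw [ih m (by lia), truncation, Matrix.of_apply]
    · rw [truncation, Matrix.of_apply, P.mulX_eq_zero hm, mul_zero, mul_zero]

theorem vecMul_charmatrix_truncation (n : ℕ) (l : Fin n) :
    Matrix.vecMul (fun k : Fin n => P k) (P.truncation n).charmatrix l = P.mulX n l • P n := by
  have hX : X * P l = ∑ k : Fin n, P.mulX k l • P k + P.mulX n l • P n := by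
    rw [P.X_mul_eq_sum (by lia : (l : ℕ) + 1 < n + 1), Finset.sum_range_succ, Finset.sum_range]
  calc Matrix.vecMul (fun k : Fin n => P k) (P.truncation n).charmatrix l
      = X * P l - ∑ k : Fin n, P.mulX k l • P k := by
        simp [Matrix.vecMul, dotProduct, Matrix.charmatrix_apply, Matrix.diagonal_apply, mul_sub,
          truncation, smul_eq_C_mul, mul_comm]
    _ = P.mulX n l • P n := by rw [hX, add_sub_cancel_left]

theorem charpoly_truncation (n : ℕ) : (P.truncation n).charpoly = P n := by
  refine eq_of_monic_of_dvd_of_natDegree_le (P.monic n) (P.truncation n).charpoly_monic ?_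
    (by rw [Matrix.charpoly_natDegree_eq_dim, Fintype.card_fin, Sequence.natDegree_eq])
  rcases Nat.eq_zero_or_pos n with rfl | hn
  · exact P.zero_eq_one ▸ one_dvd _
  -- Multiply `(P 0, …, P (n - 1)) * charmatrix ≡ 0 mod P n` by the adjugate; since `P 0 = 1`,
  -- the first entry of the result is the characteristic polynomial.
  set v : Fin n → R[X] := fun k => P k
  set M := (P.truncation n).charmatrix
  have hP0 : v ⟨0, hn⟩ = 1 := P.zero_eq_one
  have hadj : Matrix.vecMul (Matrix.vecMul v M) M.adjugate ⟨0, hn⟩ = (P.truncation n).charpoly := by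
    rw [Matrix.vecMul_vecMul, Matrix.mul_adjugate, Matrix.vecMul_smul, Matrix.vecMul_one,
      Pi.smul_apply, hP0, smul_eq_mul, mul_one]
    rfl
  rw [← hadj]
  rw [Matrix.vecMul, dotProduct]
  refine Finset.dvd_sum fun l _ => Dvd.dvd.mul_right ?_ _
  rw [P.vecMul_charmatrix_truncation, smul_eq_C_mul]
  exact dvd_mul_left _ _

end Algebra

theorem exists_tendsto_mulXPow {R : Type*} [CommRing R] [IsDomain R] [TopologicalSpace R]
    [IsTopologicalSemiring R] (P : MonicSequence R)
    (hP : ∀ r s, ∃ a, Tendsto (fun n => P.mulX (n + r) (n + s)) atTop (𝓝 a)) (j r s : ℕ) :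
    ∃ a, Tendsto (fun n => P.mulXPow j (n + r) (n + s)) atTop (𝓝 a) := by
  induction j generalizing r s with
  | zero =>
    refine ⟨if s = r then 1 else 0, tendsto_const_nhds.congr fun n => ?_⟩
    simp only [mulXPow_zero, add_right_inj]
  | succ j ih =>
    have hsum (n : ℕ) : P.mulXPow (j + 1) (n + j + r) (n + j + s) =
        ∑ t ∈ Finset.range (j + s + 2),
          P.mulXPow j (n + (j + r)) (n + t) * P.mulX (n + t) (n + (j + s)) := by
      rw [P.mulXPow_succ (by lia : n + j + s + 1 < n + (j + s + 2)), Finset.sum_range_add,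
        Finset.sum_eq_zero fun m hm => ?_, zero_add]
      · simp only [add_assoc]
      · rw [P.mulXPow_eq_zero (by grind), zero_mul]
    choose A hA using ih
    choose B hB using hP
    refine ⟨∑ t ∈ Finset.range (j + s + 2), A (j + r) t * B t (j + s),
      (tendsto_add_atTop_iff_nat j).1 ?_⟩
    simp only [hsum]
    exact tendsto_finsetSum _ fun t _ => (hA (j + r) t).mul (hB t (j + s))

section Trace

variable {𝕜 : Type*} [NormedField 𝕜] {P : MonicSequence 𝕜} {ρ : ℝ}

theorem sum_pow_mul_norm_mulX_le (hρ : 0 ≤ ρ) (hP : ∀ k i, ‖P.mulX k (k + i)‖ ≤ ρ ^ (i + 1))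
    (n l : ℕ) : ∑ k ∈ Finset.range n, (2 * ρ) ^ k * ‖P.mulX k l‖ ≤ 4 * ρ * (2 * ρ) ^ l := by
  have hterm : ∀ k ∈ Finset.range (l + 2), ρ ^ k * ‖P.mulX k l‖ ≤ ρ ^ (l + 1) := by
    intro k hk
    rcases (Nat.lt_succ_iff.1 (Finset.mem_range.1 hk)).eq_or_lt with rfl | hlt
    · rw [mulX_succ_self, norm_one, mul_one]
    · obtain ⟨i, rfl⟩ := Nat.exists_eq_add_of_le (Nat.lt_succ_iff.1 hlt)
      calc ρ ^ k * ‖P.mulX k (k + i)‖ ≤ ρ ^ k * ρ ^ (i + 1) := by gcongr; exact hP k i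
        _ = ρ ^ (k + i + 1) := by rw [← pow_add, add_assoc]
  calc ∑ k ∈ Finset.range n, (2 * ρ) ^ k * ‖P.mulX k l‖
      ≤ ∑ k ∈ Finset.range (n + (l + 2)), (2 * ρ) ^ k * ‖P.mulX k l‖ :=
        Finset.sum_le_sum_of_subset_of_nonneg (Finset.range_mono (by lia))
          fun _ _ _ => by positivity
    _ = ∑ k ∈ Finset.range (l + 2), 2 ^ k * (ρ ^ k * ‖P.mulX k l‖) := by
        simp only [mul_pow, mul_assoc]
        refine (Finset.sum_subset (Finset.range_mono (by lia)) fun k _ hk => ?_).symm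
        rw [P.mulX_eq_zero (not_lt.1 (Finset.mem_range.not.1 hk)), norm_zero, mul_zero, mul_zero]
    _ ≤ ∑ k ∈ Finset.range (l + 2), 2 ^ k * ρ ^ (l + 1) := by
        gcongr with k hk
        exact hterm k hk
    _ = (2 ^ (l + 2) - 1) * ρ ^ (l + 1) := by
        rw [← Finset.sum_mul, geom_sum_eq (by norm_num)]
        norm_num
    _ ≤ 2 ^ (l + 2) * ρ ^ (l + 1) := by gcongr; exact sub_le_self _ zero_le_one
    _ = 4 * ρ * (2 * ρ) ^ l := by ring

theorem norm_truncation_pow_apply_self_le (hρ : 0 < ρ)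
    (hP : ∀ k i, ‖P.mulX k (k + i)‖ ≤ ρ ^ (i + 1)) {n : ℕ} (j : ℕ) (l : Fin n) :
    ‖(P.truncation n ^ j) l l‖ ≤ (4 * ρ) ^ j := by
  refine norm_pow_apply_self_le_of_sum_mul_norm_le (w := fun k : Fin n => (2 * ρ) ^ (k : ℕ))
    (fun _ => by positivity) (fun l => ?_) j l
  simpa only [truncation, Matrix.of_apply, Finset.sum_range] using
    sum_pow_mul_norm_mulX_le hρ.le hP n l

theorem tendsto_trace_truncation_pow [NormedSpace ℝ 𝕜] (hρ : 0 < ρ)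
    (hP : ∀ k i, ‖P.mulX k (k + i)‖ ≤ ρ ^ (i + 1)) {j : ℕ} {a : 𝕜}
    (ha : Tendsto (fun n => P.mulXPow j n n) atTop (𝓝 a)) :
    Tendsto (fun n : ℕ => (n⁻¹ : ℝ) • (P.truncation n ^ j).trace) atTop (𝓝 a) := by
  obtain ⟨D, hD⟩ := (Metric.isBounded_range_of_tendsto _ ha).exists_norm_le
  replace hD (n : ℕ) : ‖P.mulXPow j n n‖ ≤ D := hD _ (Set.mem_range_self n)
  have hD0 : 0 ≤ D := (norm_nonneg _).trans (hD 0)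
  have hcorner (n : ℕ) : ‖(P.truncation n ^ j).trace - ∑ k ∈ Finset.range n, P.mulXPow j k k‖ ≤
      j * ((4 * ρ) ^ j + D) := by
    rw [Matrix.trace, Finset.sum_range, ← Finset.sum_sub_distrib]
    refine norm_sum_fin_le_of_eq_zero (by positivity) (fun k hk => ?_) fun k => ?_
    · rw [Matrix.diag_apply, P.truncation_pow_apply j k k hk, sub_self]
    · exact (norm_sub_le _ _).trans
        (add_le_add (norm_truncation_pow_apply_self_le hρ hP j k) (hD k))
  have hlim : Tendsto (fun n : ℕ => (n⁻¹ : ℝ) * (j * ((4 * ρ) ^ j + D))) atTop (𝓝 0) := by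
    simpa using tendsto_inv_atTop_nhds_zero_nat.mul_const (j * ((4 * ρ) ^ j + D))
  have hdiff : Tendsto (fun n : ℕ => (n⁻¹ : ℝ) • ((P.truncation n ^ j).trace -
      ∑ k ∈ Finset.range n, P.mulXPow j k k)) atTop (𝓝 0) := by
    refine squeeze_zero_norm (fun n => ?_) hlim
    rw [norm_smul, Real.norm_of_nonneg (by positivity)]
    gcongr
    exact hcorner n
  simpa only [← smul_add, sub_add_cancel, zero_add] using hdiff.add ha.cesaro_smul

end Trace

/-! ### Recovering the diagonals from ratio asymptotics -/

section RatioAsymptotics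

variable {𝕜 : Type*} [NormedField 𝕜] (P : MonicSequence 𝕜)

/-- With `T` the matrix of multiplication by `X` in the basis `P`, the part of column `n + q` of
`T` in rows `m ≤ n`, paired with `P m z / P n z`. For large `z` the row `m = n` dominates, so these
numbers, which ratio asymptotics control, approximate the diagonal entries `T n (n + q)`. -/
noncomputable def tailRatio (z : 𝕜) (q n : ℕ) : 𝕜 :=
  (∑ m ∈ Finset.range (n + 1), P.mulX m (n + q) * (P m).eval z) / (P n).eval z

theorem eval_succ_div_eval {z : 𝕜} {n : ℕ} (hn : (P n).eval z ≠ 0) :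
    (P (n + 1)).eval z / (P n).eval z = z - P.tailRatio z 0 n := by
  have hrec := congrArg (eval z) (P.X_mul_eq_sum (lt_add_one (n + 1)))
  rw [Finset.sum_range_succ, mulX_succ_self, one_smul, eval_add, eval_finsetSum, eval_mul,
    eval_X] at hrec
  simp only [eval_smul, smul_eq_mul] at hrec
  rw [tailRatio, add_zero, eq_sub_iff_add_eq, ← add_div, add_comm, ← hrec,
    mul_div_cancel_right₀ _ hn]

theorem tailRatio_succ {z : 𝕜} {n : ℕ} (hn : (P n).eval z ≠ 0) (hn' : (P (n + 1)).eval z ≠ 0)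
    (q : ℕ) : P.tailRatio z q (n + 1) =
      P.mulX (n + 1) (n + 1 + q) + (P n).eval z / (P (n + 1)).eval z * P.tailRatio z (q + 1) n := by
  rw [tailRatio, tailRatio, Finset.sum_range_succ, add_assoc n 1 q, add_comm 1 q]
  field_simp
  ring

variable {P} {ρ : ℝ} {z : 𝕜}

theorem half_norm_le_norm_eval_succ_div_eval {n : ℕ} (hn : (P n).eval z ≠ 0) (hz : 4 * ρ ≤ ‖z‖)
    (htail : ‖P.tailRatio z 0 n‖ ≤ 2 * ρ) : ‖z‖ / 2 ≤ ‖(P (n + 1)).eval z / (P n).eval z‖ := by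
  rw [P.eval_succ_div_eval hn]
  linarith [norm_sub_norm_le z (P.tailRatio z 0 n)]

variable (hρ : 0 < ρ) (hP : ∀ k i, ‖P.mulX k (k + i)‖ ≤ ρ ^ (i + 1))

include hρ hP

theorem eval_ne_zero_and_norm_tailRatio_le (hz : 4 * ρ ≤ ‖z‖) (n : ℕ) :
    (P n).eval z ≠ 0 ∧ ∀ q, ‖P.tailRatio z q n‖ ≤ 2 * ρ ^ (q + 1) := by
  induction n with
  | zero =>
    refine ⟨by simp [P.zero_eq_one], fun q => ?_⟩
    calc ‖P.tailRatio z q 0‖ = ‖P.mulX 0 (0 + q)‖ := by simp [tailRatio, P.zero_eq_one]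
      _ ≤ ρ ^ (q + 1) := hP 0 q
      _ ≤ 2 * ρ ^ (q + 1) := le_mul_of_one_le_left (by positivity) one_le_two
  | succ n ih =>
    obtain ⟨hn, htail⟩ := ih
    have hgrow : 2 * ρ ≤ ‖(P (n + 1)).eval z / (P n).eval z‖ := by
      linarith [half_norm_le_norm_eval_succ_div_eval hn hz (by simpa using htail 0)]
    have hn' : (P (n + 1)).eval z ≠ 0 :=
      (div_ne_zero_iff.1 (norm_pos_iff.1 (hgrow.trans_lt' (by positivity)))).1
    have hshrink : ‖(P n).eval z / (P (n + 1)).eval z‖ ≤ (2 * ρ)⁻¹ := by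
      rw [← inv_div, norm_inv]
      gcongr
    refine ⟨hn', fun q => ?_⟩
    calc ‖P.tailRatio z q (n + 1)‖ ≤ ρ ^ (q + 1) + (2 * ρ)⁻¹ * (2 * ρ ^ (q + 2)) := by
          rw [P.tailRatio_succ hn hn']
          refine norm_add_le_of_le (hP _ _) ?_
          rw [norm_mul]
          gcongr
          exact htail (q + 1)
      _ = 2 * ρ ^ (q + 1) := by field_simp; ring

theorem norm_eval_div_eval_succ_le
    (hz : 4 * ρ ≤ ‖z‖) (n : ℕ) : ‖(P n).eval z / (P (n + 1)).eval z‖ ≤ 2 / ‖z‖ := by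
  obtain ⟨hn, htail⟩ := eval_ne_zero_and_norm_tailRatio_le hρ hP hz n
  have hzpos : 0 < ‖z‖ := hz.trans_lt' (by positivity)
  rw [← inv_div, norm_inv, ← inv_div ‖z‖]
  gcongr
  exact half_norm_le_norm_eval_succ_div_eval hn hz (by simpa using htail 0)

theorem exists_tendsto_tailRatio_zero (hz : 4 * ρ ≤ ‖z‖)
    (hratio : ∃ w, Tendsto (fun n => (P n).eval z / (P (n + 1)).eval z) atTop (𝓝 w)) :
    ∃ w, Tendsto (P.tailRatio z 0) atTop (𝓝 w) := by
  obtain ⟨w, hw⟩ := hratio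
  have hbound := eval_ne_zero_and_norm_tailRatio_le hρ hP hz
  have hquot (n : ℕ) : ((P n).eval z / (P (n + 1)).eval z)⁻¹ = z - P.tailRatio z 0 n := by
    rw [inv_div, P.eval_succ_div_eval (hbound n).1]
  have hlower (n : ℕ) : (‖z‖ + 2 * ρ)⁻¹ ≤ ‖(P n).eval z / (P (n + 1)).eval z‖ := by
    rw [← inv_inv ((P n).eval z / _), hquot, norm_inv]
    refine inv_anti₀ ?_ (norm_sub_le_of_le le_rfl (by simpa using (hbound n).2 0))
    rw [← hquot]
    exact norm_pos_iff.2 (inv_ne_zero (div_ne_zero (hbound n).1 (hbound (n + 1)).1))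
  have hw0 : w ≠ 0 := norm_pos_iff.1 <|
    (ge_of_tendsto' hw.norm hlower).trans_lt' (by positivity)
  refine ⟨z - w⁻¹, ((hw.inv₀ hw0).const_sub z).congr fun n => ?_⟩
  rw [hquot, sub_sub_cancel]

theorem exists_tendsto_tailRatio_succ (hz : 4 * ρ ≤ ‖z‖) {q : ℕ}
    (hzero : ∃ w, Tendsto (P.tailRatio z 0) atTop (𝓝 w))
    (htail : ∃ w, Tendsto (P.tailRatio z q) atTop (𝓝 w))
    (hdiag : ∃ a, Tendsto (fun n => P.mulX n (n + q)) atTop (𝓝 a)) :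
    ∃ w, Tendsto (P.tailRatio z (q + 1)) atTop (𝓝 w) := by
  obtain ⟨u, hu⟩ := hzero
  obtain ⟨v, hv⟩ := htail
  obtain ⟨a, ha⟩ := hdiag
  refine ⟨(z - u) * (v - a), ((hu.const_sub z).mul
    ((tendsto_add_atTop_iff_nat 1).2 (hv.sub ha))).congr fun n => ?_⟩
  have hn := (eval_ne_zero_and_norm_tailRatio_le hρ hP hz n).1
  have hn' := (eval_ne_zero_and_norm_tailRatio_le hρ hP hz (n + 1)).1
  rw [← P.eval_succ_div_eval hn, P.tailRatio_succ hn hn']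
  field_simp
  ring

theorem tendstoUniformly_tailRatio (q : ℕ) :
    TendstoUniformly (fun z n => P.tailRatio z q (n + 1)) (fun n => P.mulX (n + 1) (n + 1 + q))
      (Bornology.cobounded 𝕜) := by
  refine Metric.tendstoUniformly_iff.2 fun ε hε => ?_
  have hlim : Tendsto (fun z : 𝕜 => 2 / ‖z‖ * (2 * ρ ^ (q + 2))) (Bornology.cobounded 𝕜) (𝓝 0) := by
    simpa using (tendsto_norm_cobounded_atTop.const_div_atTop 2).mul_const (2 * ρ ^ (q + 2))
  filter_upwards [hlim.eventually_lt_const hε, eventually_cobounded_le_norm (4 * ρ)] with z hlt hz n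
  obtain ⟨hn, htail⟩ := eval_ne_zero_and_norm_tailRatio_le hρ hP hz n
  have hn' := (eval_ne_zero_and_norm_tailRatio_le hρ hP hz (n + 1)).1
  rw [P.tailRatio_succ hn hn', dist_self_add_right, norm_mul]
  refine hlt.trans_le' ?_
  gcongr
  · exact norm_eval_div_eval_succ_le hρ hP hz n
  · exact htail (q + 1)

theorem exists_tendsto_mulX_add [CompleteSpace 𝕜]
    (hratio : ∃ᶠ z in Bornology.cobounded 𝕜,
      ∃ w, Tendsto (fun n => (P n).eval z / (P (n + 1)).eval z) atTop (𝓝 w)) (q : ℕ) :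
    ∃ a, Tendsto (fun n => P.mulX n (n + q)) atTop (𝓝 a) := by
  have hdiag {q : ℕ} (htail : ∃ᶠ z in Bornology.cobounded 𝕜,
      ∃ w, Tendsto (P.tailRatio z q) atTop (𝓝 w)) :
      ∃ a, Tendsto (fun n => P.mulX n (n + q)) atTop (𝓝 a) := by
    have hcauchy := cauchySeq_of_tendstoUniformly (tendstoUniformly_tailRatio hρ hP q) <|
      htail.mono fun z ⟨_, hw⟩ => ((tendsto_add_atTop_iff_nat 1).2 hw).cauchySeq
    exact (cauchySeq_tendsto_of_complete hcauchy).imp fun _ ha =>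
      (tendsto_add_atTop_iff_nat (f := fun n => P.mulX n (n + q)) 1).1 ha
  have hlarge := hratio.and_eventually (eventually_cobounded_le_norm (4 * ρ))
  have hzero : ∀ z : 𝕜, ((∃ w, Tendsto (fun n => (P n).eval z / (P (n + 1)).eval z) atTop (𝓝 w)) ∧
      4 * ρ ≤ ‖z‖) → ∃ w, Tendsto (P.tailRatio z 0) atTop (𝓝 w) :=
    fun z hz => exists_tendsto_tailRatio_zero hρ hP hz.2 hz.1
  refine hdiag (hlarge.mono fun z hz => ?_)
  induction q generalizing z with
  | zero => exact hzero z hz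
  | succ q ih =>
    exact exists_tendsto_tailRatio_succ hρ hP hz.2 (hzero z hz) (ih z hz) (hdiag (hlarge.mono ih))

theorem exists_tendsto_mulX [CompleteSpace 𝕜]
    (hratio : ∃ᶠ z in Bornology.cobounded 𝕜,
      ∃ w, Tendsto (fun n => (P n).eval z / (P (n + 1)).eval z) atTop (𝓝 w)) (r s : ℕ) :
    ∃ a, Tendsto (fun n => P.mulX (n + r) (n + s)) atTop (𝓝 a) := by
  rcases lt_trichotomy r (s + 1) with h | rfl | h
  · obtain ⟨q, rfl⟩ := Nat.exists_eq_add_of_le (Nat.lt_succ_iff.1 h)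
    obtain ⟨a, ha⟩ := exists_tendsto_mulX_add hρ hP hratio q
    refine ⟨a, ?_⟩
    simpa only [add_assoc] using (tendsto_add_atTop_iff_nat r).2 ha
  · simp only [← add_assoc, mulX_succ_self]
    exact ⟨1, tendsto_const_nhds⟩
  · refine ⟨0, tendsto_const_nhds.congr fun n => ?_⟩
    rw [P.mulX_eq_zero (by lia)]

end RatioAsymptotics

end MonicSequence

/-! ### Orthogonal polynomials in `L²(μ)` -/

section L2

variable {μ : Measure ℂ}

theorem isMonicOfDegree_monicPoly (μ : Measure ℂ) (n : ℕ) :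
    IsMonicOfDegree (monicPoly μ n) n := by
  induction n using Nat.strong_induction_on with
  | _ n ih =>
    rw [monicPoly]
    rcases n with _ | n
    · simp
    · refine (isMonicOfDegree_X_pow ℂ (n + 1)).sub (Nat.lt_succ_iff.2 ?_)
      refine natDegree_sum_le_of_forall_le _ _ fun k _ => (natDegree_C_mul_le _ _).trans ?_
      rw [(ih k k.2).natDegree_eq]
      exact Nat.lt_succ_iff.1 k.2

/-- The monic orthogonal polynomials of `μ`, as a `MonicSequence`. -/
noncomputable def monicSequence (μ : Measure ℂ) : MonicSequence ℂ where
  elems' := monicPoly μ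
  degree_eq' n := (degree_eq_iff_natDegree_eq (isMonicOfDegree_monicPoly μ n).ne_zero).2
    (isMonicOfDegree_monicPoly μ n).natDegree_eq
  monic' n := (isMonicOfDegree_monicPoly μ n).monic

theorem monicSequence_apply (μ : Measure ℂ) (n : ℕ) : monicSequence μ n = monicPoly μ n := rfl

variable [IsFiniteMeasure μ] (hc : IsCompact μ.support)

/-- A polynomial as an element of `L²(μ)`. -/
noncomputable def polyL2 : ℂ[X] →ₗ[ℂ] Lp ℂ 2 μ where
  toFun p := (memLp_of_isCompact_support hc p.continuous 2).toLp p.eval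
  map_add' p q := by
    rw [← MemLp.toLp_add]
    congr with z
    exact eval_add
  map_smul' c p := by
    rw [RingHom.id_apply, ← MemLp.toLp_const_smul]
    congr with z
    exact eval_smul ..

theorem coeFn_polyL2 (p : ℂ[X]) : polyL2 hc p =ᵐ[μ] p.eval :=
  (memLp_of_isCompact_support hc p.continuous 2).coeFn_toLp

theorem inner_polyL2 (p q : ℂ[X]) : inner ℂ (polyL2 hc p) (polyL2 hc q) = polyInner μ p q := by
  rw [L2.inner_def, polyInner]
  refine integral_congr_ae ?_
  filter_upwards [coeFn_polyL2 hc p, coeFn_polyL2 hc q] with z hp hq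
  rw [hp, hq, RCLike.inner_apply']

theorem polyInner_self (p : ℂ[X]) : polyInner μ p p = ((‖polyL2 hc p‖ ^ 2 : ℝ) : ℂ) := by
  rw [← inner_polyL2 hc, inner_self_eq_norm_sq_to_K, Complex.ofReal_pow]
  rfl

theorem norm_polyL2 (p : ℂ[X]) : ‖polyL2 hc p‖ = √(∫ z, ‖p.eval z‖ ^ 2 ∂μ) := by
  have hint : polyInner μ p p = ((∫ z, ‖p.eval z‖ ^ 2 ∂μ : ℝ) : ℂ) := by
    rw [polyInner, ← integral_complex_ofReal]
    simp only [Complex.conj_mul', Complex.ofReal_pow]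
  rw [norm_eq_sqrt_re_inner (𝕜 := ℂ), inner_polyL2, hint, RCLike.re_eq_complex_re,
    Complex.ofReal_re]

theorem norm_polyL2_X_mul_le {ρ : ℝ} (hρ : μ.support ⊆ Metric.closedBall 0 ρ) (p : ℂ[X]) :
    ‖polyL2 hc (X * p)‖ ≤ ρ * ‖polyL2 hc p‖ := by
  refine Lp.norm_le_mul_norm_of_ae_le_mul ?_
  filter_upwards [coeFn_polyL2 hc (X * p), coeFn_polyL2 hc p, Measure.support_mem_ae]
    with z hXp hp hz
  rw [hXp, hp, eval_mul, eval_X, norm_mul]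
  gcongr
  exact mem_closedBall_zero_iff.1 (hρ hz)

theorem polyL2_ne_zero (hinf : μ.support.Infinite) {p : ℂ[X]} (hp : p ≠ 0) : polyL2 hc p ≠ 0 := by
  intro h
  have hroots : μ.support ⊆ {z | p.eval z = 0} := by
    refine Measure.support_subset_of_isClosed (isClosed_eq p.continuous continuous_const) ?_
    filter_upwards [coeFn_polyL2 hc p, Lp.coeFn_zero ℂ 2 μ] with z hz hz0
    exact hz.symm.trans (h ▸ hz0)
  exact hinf ((p.finite_setOfPred_isRoot hp).subset hroots)

theorem polyL2_monicPoly (n : ℕ) : polyL2 hc (monicPoly μ n) =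
    InnerProductSpace.gramSchmidt ℂ (fun n => polyL2 hc (X ^ n)) n := by
  induction n using Nat.strong_induction_on with
  | _ n ih =>
    rw [InnerProductSpace.gramSchmidt_def, monicPoly, map_sub, map_sum, Nat.Iio_eq_range,
      Finset.sum_range]
    congr 1
    refine Finset.sum_congr rfl fun k _ => ?_
    rw [← smul_eq_C_mul, map_smul, ← ih k k.2, Submodule.starProjection_singleton, inner_polyL2,
      polyInner_self hc]
    rfl

theorem inner_polyL2_monicPoly (k : ℕ) (p : ℂ[X]) :
    inner ℂ (polyL2 hc (monicPoly μ k)) (polyL2 hc p) =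
      ‖polyL2 hc (monicPoly μ k)‖ ^ 2 * (monicSequence μ).basis.repr p k := by
  set P := monicSequence μ
  suffices innerₛₗ ℂ (polyL2 hc (monicPoly μ k)) ∘ₗ polyL2 hc =
      (‖polyL2 hc (monicPoly μ k)‖ ^ 2 : ℂ) • P.basis.coord k from LinearMap.congr_fun this p
  refine P.basis.ext fun l => ?_
  rw [LinearMap.comp_apply, innerₛₗ_apply_apply, LinearMap.smul_apply, Module.Basis.coord_apply,
    P.basis_apply, P.repr_apply_self, monicSequence_apply]
  split_ifs with h
  · rw [h, inner_self_eq_norm_sq_to_K, smul_eq_mul, mul_one]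
    rfl
  · rw [smul_zero, polyL2_monicPoly, polyL2_monicPoly]
    exact InnerProductSpace.gramSchmidt_orthogonal ℂ _ (Ne.symm h)

theorem norm_polyL2_monicPoly_sq_mul_norm_mulX_le {ρ : ℝ}
    (hρ : μ.support ⊆ Metric.closedBall 0 ρ) (k l : ℕ) :
    ‖polyL2 hc (monicPoly μ k)‖ ^ 2 * ‖(monicSequence μ).mulX k l‖ ≤
      ‖polyL2 hc (monicPoly μ k)‖ * (ρ * ‖polyL2 hc (monicPoly μ l)‖) := by
  calc _ = ‖inner ℂ (polyL2 hc (monicPoly μ k)) (polyL2 hc (X * monicPoly μ l))‖ := by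
        rw [inner_polyL2_monicPoly, norm_mul, norm_pow, Complex.norm_real, norm_norm,
          MonicSequence.mulX, MonicSequence.mulXPow, pow_one, monicSequence_apply]
    _ ≤ ‖polyL2 hc (monicPoly μ k)‖ * ‖polyL2 hc (X * monicPoly μ l)‖ := norm_inner_le_norm _ _
    _ ≤ _ := by gcongr; exact norm_polyL2_X_mul_le hc hρ _

theorem norm_polyL2_monicPoly_pos (hinf : μ.support.Infinite) (n : ℕ) :
    0 < ‖polyL2 hc (monicPoly μ n)‖ :=
  norm_pos_iff.2 (polyL2_ne_zero hc hinf (isMonicOfDegree_monicPoly μ n).ne_zero)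

theorem norm_polyL2_monicPoly_add_le (hinf : μ.support.Infinite) {ρ : ℝ} (hρ0 : 0 ≤ ρ)
    (hρ : μ.support ⊆ Metric.closedBall 0 ρ) (k i : ℕ) :
    ‖polyL2 hc (monicPoly μ (k + i))‖ ≤ ρ ^ i * ‖polyL2 hc (monicPoly μ k)‖ := by
  induction i with
  | zero => simp
  | succ i ih =>
    have hpos := norm_polyL2_monicPoly_pos hc hinf (k + i + 1)
    have hstep := norm_polyL2_monicPoly_sq_mul_norm_mulX_le hc hρ (k + i + 1) (k + i)
    rw [MonicSequence.mulX_succ_self, norm_one, mul_one, sq] at hstep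
    calc _ ≤ ρ * ‖polyL2 hc (monicPoly μ (k + i))‖ := le_of_mul_le_mul_left hstep hpos
      _ ≤ ρ * (ρ ^ i * ‖polyL2 hc (monicPoly μ k)‖) := by gcongr
      _ = _ := by rw [pow_succ', mul_assoc]

include hc in
theorem norm_mulX_monicSequence_le (hinf : μ.support.Infinite) {ρ : ℝ} (hρ0 : 0 ≤ ρ)
    (hρ : μ.support ⊆ Metric.closedBall 0 ρ) (k i : ℕ) :
    ‖(monicSequence μ).mulX k (k + i)‖ ≤ ρ ^ (i + 1) := by
  have hpos := norm_polyL2_monicPoly_pos hc hinf k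
  refine le_of_mul_le_mul_left ?_ (pow_pos hpos 2)
  calc _ ≤ ‖polyL2 hc (monicPoly μ k)‖ * (ρ * ‖polyL2 hc (monicPoly μ (k + i))‖) :=
        norm_polyL2_monicPoly_sq_mul_norm_mulX_le hc hρ k (k + i)
    _ ≤ ‖polyL2 hc (monicPoly μ k)‖ * (ρ * (ρ ^ i * ‖polyL2 hc (monicPoly μ k)‖)) := by
        gcongr
        exact norm_polyL2_monicPoly_add_le hc hinf hρ0 hρ k i
    _ = _ := by ring

theorem leadCoeff_eq (n : ℕ) : leadCoeff μ n = ‖polyL2 hc (monicPoly μ n)‖⁻¹ := by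
  rw [leadCoeff, norm_polyL2]

include hc in
theorem leadCoeff_ne_zero (hinf : μ.support.Infinite) (n : ℕ) : leadCoeff μ n ≠ 0 := by
  rw [leadCoeff_eq hc]
  exact (inv_pos.2 (norm_polyL2_monicPoly_pos hc hinf n)).ne'

include hc in
theorem integral_pow_mul_norm_orthonormalPoly_sq (hinf : μ.support.Infinite) (j n : ℕ) :
    ∫ z, z ^ j * ((‖(orthonormalPoly μ n).eval z‖ ^ 2 : ℝ) : ℂ) ∂μ =
      (monicSequence μ).mulXPow j n n := by
  have hne : (‖polyL2 hc (monicPoly μ n)‖ : ℂ) ≠ 0 :=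
    Complex.ofReal_ne_zero.2 (norm_polyL2_monicPoly_pos hc hinf n).ne'
  calc _ = ∫ z, (leadCoeff μ n : ℂ) ^ 2 *
          (conj ((monicPoly μ n).eval z) * (X ^ j * monicPoly μ n).eval z) ∂μ := by
        congr 1 with z
        rw [orthonormalPoly, Complex.ofReal_pow, ← Complex.conj_mul']
        simp only [eval_mul, eval_C, eval_pow, eval_X, map_mul, Complex.conj_ofReal]
        ring
    _ = (leadCoeff μ n : ℂ) ^ 2 * polyInner μ (monicPoly μ n) (X ^ j * monicPoly μ n) :=
        integral_const_mul _ _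
    _ = (monicSequence μ).mulXPow j n n := by
        rw [← inner_polyL2 hc, inner_polyL2_monicPoly, leadCoeff_eq hc, Complex.ofReal_inv,
          ← mul_assoc, ← mul_pow, inv_mul_cancel₀ hne, one_pow, one_mul]
        rfl

end L2

theorem integral_zeroCounting {μ : Measure ℂ} {n : ℕ} (hlead : leadCoeff μ n ≠ 0) (j : ℕ) :
    ∫ z, z ^ j ∂(zeroCounting μ n) = (n⁻¹ : ℝ) • ((monicSequence μ).truncation n ^ j).trace := by
  rw [zeroCounting, integral_smul_measure, integral_multiset_sum_dirac, ENNReal.toReal_inv,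
    ENNReal.toReal_natCast, orthonormalPoly, roots_C_mul _ (Complex.ofReal_ne_zero.2 hlead),
    trace_pow_eq_sum_roots_charpoly, MonicSequence.charpoly_truncation, monicSequence_apply]

end OrthoPoly

theorem corollary1p11_general (μ : Measure ℂ) [IsFiniteMeasure μ]
    (hcompact : IsCompact μ.support) (hinfinite : μ.support.Infinite)
    (hratio : ∃ᶠ z in Bornology.cobounded ℂ, ∃ w, Tendsto
      (fun n => (OrthoPoly.monicPoly μ n).eval z / (OrthoPoly.monicPoly μ (n + 1)).eval z)
      atTop (𝓝 w)) (j : ℕ) :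
    ∃ L : ℂ,
      Tendsto (fun n : ℕ => ∫ z, z ^ j ∂(OrthoPoly.zeroCounting μ n)) atTop (𝓝 L) ∧
      Tendsto (fun n : ℕ =>
        ∫ z, z ^ j * ((‖(OrthoPoly.orthonormalPoly μ n).eval z‖ ^ 2 : ℝ) : ℂ) ∂μ)
        atTop (𝓝 L) := by
  obtain ⟨ρ, hρ0, hρ⟩ := hcompact.isBounded.subset_closedBall_lt 0 0
  have hdecay := OrthoPoly.norm_mulX_monicSequence_le hcompact hinfinite hρ0.le hρ
  obtain ⟨L, hL⟩ := (OrthoPoly.monicSequence μ).exists_tendsto_mulXPow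
    (OrthoPoly.MonicSequence.exists_tendsto_mulX hρ0 hdecay hratio) j 0 0
  refine ⟨L, ?_, ?_⟩
  · simp only [OrthoPoly.integral_zeroCounting
      (OrthoPoly.leadCoeff_ne_zero hcompact hinfinite _)]
    exact OrthoPoly.MonicSequence.tendsto_trace_truncation_pow hρ0 hdecay hL
  · simp only [OrthoPoly.integral_pow_mul_norm_orthonormalPoly_sq hcompact hinfinite]
    exact hL

theorem corollary1p11 (μ : Measure ℂ) [IsFiniteMeasure μ]
    (hcompact : IsCompact μ.support) (hinfinite : μ.support.Infinite)
    (R : ℝ) (hR : 0 < R) (f : OnePoint ℂ → ℂ) (hf : OrthoPoly.AnalyticOnExterior f R)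
    (hratio : ∀ z ∈ OrthoPoly.exterior R,
      Tendsto (fun n : ℕ =>
        OrthoPoly.ratioAt (OrthoPoly.monicPoly μ n) (OrthoPoly.monicPoly μ (n + 1)) z)
        atTop (𝓝 (f z))) :
    ∀ j : ℕ, ∃ L : ℂ,
      Tendsto (fun n : ℕ => ∫ z, z ^ j ∂(OrthoPoly.zeroCounting μ n)) atTop (𝓝 L) ∧
      Tendsto (fun n : ℕ =>
        ∫ z, z ^ j * ((‖(OrthoPoly.orthonormalPoly μ n).eval z‖ ^ 2 : ℝ) : ℂ) ∂μ)
        atTop (𝓝 L) :=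
  corollary1p11_general μ hcompact hinfinite <|
    ((tendsto_norm_cobounded_atTop.eventually_gt_atTop R).mono fun z hz =>
      ⟨f z, hratio z (Or.inr ⟨z, hz, rfl⟩)⟩).frequently
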